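/- Call a polynomial $f\in\mathbb{R}[x]$ hyperbolic if $f=0$ or all complex zeros of $f$ are real, and say that a linear operator $T:\mathbb{R}[x]\to\mathbb{R}[x]$ preserves hyperbolicity if $T[f]$ is hyperbolic whenever $f$ is. If $\{P_n\}_{n\ge 0}$ is a basis of $\mathbb{R}[x]$, a real sequence $\{A_n\}_{n\ge 0}$ is called a $P_n$-multiplier sequence if there is a hyperbolicity preserving linear operator $T$ with $T[P_n]=A_nP_n$ for every $n\ge 0$. A simple set is a sequence $\{P_n\}_{n\ge 0}$ in $\mathbb{R}[x]$ with $\deg P_n=n$ for every $n$ (it is then a basis of $\mathbb{R}[x]$). Theorem. Let $\{P_n\}_{n\ge 0}$ be a simple set in $\mathbb{R}[x]$, let $\{A_n\}_{n\ge 0}$ be a sequence of real numbers, and let $c_0,c_1,c_2,r_1,r_2,r_3\in\mathbb{R}$ with $c_2\neq 0$. If $r_1=r_2$, assume moreover that $c_1(x-r_3)=c_1(x-r_1)$ as polynomials, i.e. that $c_1=0$ or $r_3=r_1$. Suppose that for every $n\ge 0$ the polynomial $y=P_n$ satisfies $$c_2(x-r_1)(x-r_2)y''+c_1(x-r_3)y'+c_0y=A_ny.$$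 Then $\{A_n\}$ is a $P_n$-multiplier sequence if and only if $c_0,c_1,c_2$ are of the same sign (that is, all $\ge 0$ or all $\le 0$) and $$0\le c_1^2\,\frac{(r_1-r_3)(r_3-r_2)}{(r_2-r_1)^2}-c_2c_0,$$ where the fraction is taken to be $\frac14$ when $r_1=r_2$. -/

import Mathlib

open Polynomial

/-- A real polynomial is hyperbolic if it is zero or all of its (complex) zeros are real. -/
def IsHyperbolic (f : ℝ[X]) : Prop :=
  f = 0 ∨ ∀ z : ℂ, aeval z f = 0 → z.im = 0

/-- A linear operator on real polynomials preserves hyperbolicity if it maps hyperbolic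
polynomials to hyperbolic polynomials. -/
def PreservesHyperbolicity (T : ℝ[X] →ₗ[ℝ] ℝ[X]) : Prop :=
  ∀ f : ℝ[X], IsHyperbolic f → IsHyperbolic (T f)

/-- For a basis `P` of the real polynomials, the real sequence `A` is a `P`-multiplier sequence
if some hyperbolicity preserver `T` satisfies `T (P n) = A n • P n` for every `n`. -/
def IsMultiplierSequence (P : Module.Basis ℕ ℝ ℝ[X]) (A : ℕ → ℝ) : Prop :=
  ∃ T : ℝ[X] →ₗ[ℝ] ℝ[X], PreservesHyperbolicity T ∧ ∀ n : ℕ, T (P n) = A n • P n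

/-- Every polynomial sequence over `ℝ` with `P n` of degree exactly `n` (a simple set)
is a basis of the real polynomials. -/
noncomputable def simpleSetBasis (P : Polynomial.Sequence ℝ) : Module.Basis ℕ ℝ ℝ[X] :=
  P.basis fun n => (leadingCoeff_ne_zero.mpr (P.ne_zero n)).isUnit

/-- The members of the basis attached to a simple set are those of the simple set. -/
theorem simpleSetBasis_apply (P : Polynomial.Sequence ℝ) (n : ℕ) : simpleSetBasis P n = P n := by
  simp [simpleSetBasis]

/-- Real numbers `a`, `b`, `c` are of the same sign, in the weak sense that `0` is allowed. -/
def SameSign (a b c : ℝ) : Prop :=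
  (0 ≤ a ∧ 0 ≤ b ∧ 0 ≤ c) ∨ (a ≤ 0 ∧ b ≤ 0 ∧ c ≤ 0)

/-- The ratio `(r₁ - r₃)(r₃ - r₂)/(r₂ - r₁)²`, taken to be `1/4` when `r₁ = r₂`. -/
noncomputable def rootRatio (r₁ r₂ r₃ : ℝ) : ℝ :=
  open scoped Classical in
  if r₁ = r₂ then 1 / 4 else (r₁ - r₃) * (r₃ - r₂) / (r₂ - r₁) ^ 2

/-! An operator is determined by its values on a basis, so the question is when T = c₂(x - r₁)(x -
r₂)D² + c₁(x - r₃)D + c₀ preserves hyperbolicity; up to sign, c₂ > 0. The stated inequality says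
that S, a quarter of the discriminant in x of c₂(x - r₁)(x - r₂) + c₁(x - r₃)s + c₀s², homogenized
in s, is positive semidefinite. Sufficiency: at a point z of the upper half plane, T is a nonzero
multiple of (D - v)(D - w), where a reverse Cauchy-Schwarz argument puts v and w in the closed upper
half plane. A Gauss-Lucas argument then gives T f(z) ≠ 0. Necessity: high powers of x - a yield S ≥
0 in a limit. A Newton inequality for the images of xᵏ(x² - M) forbids negative values of the symbol
c₂k(k - 1) + c₁k + c₀ at integers, which forces the signs. -/

theorem isHyperbolic_neg {f : ℝ[X]} (hf : IsHyperbolic f) : IsHyperbolic (-f) := by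
  rcases hf with rfl | h
  · exact Or.inl neg_zero
  · exact Or.inr fun z hz => h z (by simpa using hz)

theorem isHyperbolic_of_natDegree_le_one {f : ℝ[X]} (hf : f.natDegree ≤ 1) :
    IsHyperbolic f := by
  obtain ⟨a, b, rfl⟩ := exists_eq_X_add_C_of_natDegree_le_one hf
  by_cases ha : a = 0
  · subst ha
    by_cases hb : b = 0
    · left; simp [hb]
    · right
      intro z hz
      simp [hb] at hz
  · right
    intro z hz
    have h := congrArg Complex.im hz
    simpa [ha] using h

/-! ### Zeros and first-order factors D - w -/

/-- The sum of `1 / (z - a)` over a nonempty family of points outside the upper half plane has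
negative imaginary part for `z` in the upper half plane. -/
theorem im_sum_one_div_sub_neg {s : Multiset ℂ} (hs : s ≠ 0) (h : ∀ a ∈ s, a.im ≤ 0) {z : ℂ}
    (hz : 0 < z.im) : (s.map fun a => 1 / (z - a)).sum.im < 0 := by
  have key : ∀ a : ℂ, a.im ≤ 0 → (1 / (z - a)).im < 0 := by
    intro a ha
    have hpos : 0 < (z - a).im := by simp only [Complex.sub_im]; linarith
    have hne : z - a ≠ 0 := fun h0 => by simp [h0] at hpos
    rw [one_div, Complex.inv_im]
    exact div_neg_of_neg_of_pos (by linarith) (Complex.normSq_pos.mpr hne)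
  induction s using Multiset.induction with
  | empty => exact absurd rfl hs
  | cons a s ih =>
    rw [Multiset.map_cons, Multiset.sum_cons, Complex.add_im]
    have h1 := key a (h a (Multiset.mem_cons_self a s))
    by_cases h0 : s = 0
    · subst h0; simpa using h1
    · have := ih h0 fun b hb => h b (Multiset.mem_cons_of_mem hb)
      linarith

/-- At z the logarithmic derivative g'/g has negative imaginary part, so it cannot equal w. -/
theorem eval_derivative_sub_C_mul_ne_zero {g : ℂ[X]} (hg : 0 < g.natDegree)
    (hroots : ∀ a, g.eval a = 0 → a.im ≤ 0) {w z : ℂ} (hw : 0 ≤ w.im) (hz : 0 < z.im) :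
    (derivative g - C w * g).eval z ≠ 0 := by
  have hgz : g.eval z ≠ 0 := fun h => absurd (hroots z h) (by linarith)
  have hg0 : g ≠ 0 := fun h => by simp [h] at hg
  have hsp : g.Splits := IsAlgClosed.splits g
  have hne : g.roots ≠ 0 := by
    intro h
    have := hsp.natDegree_eq_card_roots
    rw [h] at this
    simp at this
    omega
  have him := im_sum_one_div_sub_neg hne
    (fun a ha => hroots a ((mem_roots hg0).mp ha)) hz
  intro h
  have hq := hsp.eval_derivative_div_eval_of_ne_zero hgz
  have hw' : (derivative g).eval z / g.eval z = w := by
    rw [div_eq_iff hgz]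
    simpa [sub_eq_zero] using h
  rw [← hq, hw'] at him
  linarith

theorem natDegree_derivative_sub_C_mul_pos {f : ℂ[X]} (hf : 2 ≤ f.natDegree) (w : ℂ) :
    0 < (derivative f - C w * f).natDegree := by
  by_cases hw : w = 0
  · subst hw
    rw [C_0, zero_mul, sub_zero, natDegree_derivative]
    omega
  · have h1 : (C w * f).natDegree = f.natDegree := natDegree_C_mul hw
    rw [natDegree_sub_eq_right_of_natDegree_lt, h1]
    · omega
    · rw [h1]
      exact natDegree_derivative_lt (by omega)

/-- Apply D - w, then D - v, with v and w constants: the first keeps all zeros in the closed lower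
half plane. Degree at least 2 keeps the intermediate polynomial nonconstant. -/
theorem eval_quadratic_derivative_ne_zero {f : ℂ[X]} (hf : 2 ≤ f.natDegree)
    (hroots : ∀ a, f.eval a = 0 → a.im ≤ 0) {v w z : ℂ} (hv : 0 ≤ v.im) (hw : 0 ≤ w.im)
    (hz : 0 < z.im) :
    (derivative (derivative f)).eval z - (v + w) * (derivative f).eval z + v * w * f.eval z
      ≠ 0 := by
  have h := eval_derivative_sub_C_mul_ne_zero (natDegree_derivative_sub_C_mul_pos hf w)
    (fun a ha => not_lt.mp fun hlt =>
      eval_derivative_sub_C_mul_ne_zero (by omega) hroots hw hlt ha) hv hz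
  intro h0
  apply h
  simp only [eval_sub, eval_mul, eval_C, derivative_sub, derivative_mul, derivative_C, zero_mul,
    zero_add]
  linear_combination h0

/-- A real polynomial that does not vanish on the upper half plane is hyperbolic. -/
theorem isHyperbolic_of_forall_im_pos {f : ℝ[X]} (h : ∀ z : ℂ, 0 < z.im → aeval z f ≠ 0) :
    IsHyperbolic f := by
  right
  intro z hz
  rcases lt_trichotomy z.im 0 with hlt | heq | hgt
  · refine absurd ?_ (h (starRingEnd ℂ z) (by simpa using hlt))
    rw [aeval_conj, hz, map_zero]
  · exact heq
  · exact absurd hz (h z hgt)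

/-! ### The operator and sufficiency -/

/-- The differential operator `c₂ (x - r₁) (x - r₂) D² + c₁ (x - r₃) D + c₀`. -/
noncomputable def quadraticDiffOp (c₀ c₁ c₂ r₁ r₂ r₃ : ℝ) : ℝ[X] →ₗ[ℝ] ℝ[X] :=
  LinearMap.mulLeft ℝ (C c₂ * (X - C r₁) * (X - C r₂)) ∘ₗ derivative ∘ₗ derivative
    + LinearMap.mulLeft ℝ (C c₁ * (X - C r₃)) ∘ₗ derivative + LinearMap.mulLeft ℝ (C c₀)

theorem quadraticDiffOp_apply (c₀ c₁ c₂ r₁ r₂ r₃ : ℝ) (f : ℝ[X]) :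
    quadraticDiffOp c₀ c₁ c₂ r₁ r₂ r₃ f =
      C c₂ * (X - C r₁) * (X - C r₂) * derivative (derivative f)
        + C c₁ * (X - C r₃) * derivative f + C c₀ * f := rfl

theorem quadraticDiffOp_neg (c₀ c₁ c₂ r₁ r₂ r₃ : ℝ) :
    quadraticDiffOp (-c₀) (-c₁) (-c₂) r₁ r₂ r₃ = -quadraticDiffOp c₀ c₁ c₂ r₁ r₂ r₃ := by
  refine LinearMap.ext fun f => ?_
  rw [LinearMap.neg_apply, quadraticDiffOp_apply, quadraticDiffOp_apply, C_neg, C_neg, C_neg]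
  ring

theorem preservesHyperbolicity_neg {T : ℝ[X] →ₗ[ℝ] ℝ[X]} (hT : PreservesHyperbolicity T) :
    PreservesHyperbolicity (-T) :=
  fun f hf => isHyperbolic_neg (hT f hf)

/-- A reverse Cauchy-Schwarz argument: a real quadratic form with one positive square and
nonnegative coefficients has no zero in the product of two upper half planes. -/
theorem quadratic_ne_zero_of_im_pos {c₀ c₁ c₂ r₁ r₂ r₃ : ℝ} (h₀ : 0 ≤ c₀) (h₁ : 0 ≤ c₁)
    (h₂ : 0 < c₂)
    (hS : ∀ u v : ℝ, 0 ≤ (c₁ ^ 2 / 4 - c₀ * c₂) * u ^ 2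
      + 2 * (c₁ * c₂ * (2 * r₃ - r₁ - r₂) / 4) * u * v + c₂ ^ 2 * (r₁ - r₂) ^ 2 / 4 * v ^ 2)
    {z s : ℂ} (hz : 0 < z.im) (hs : 0 < s.im) :
    c₂ * (z - r₁) * (z - r₂) + c₁ * (z - r₃) * s + c₀ * s ^ 2 ≠ 0 := by
  intro h
  obtain ⟨a, b⟩ := z
  obtain ⟨p, q⟩ := s
  simp only at hz hs
  have hre := congrArg Complex.re h
  have him := congrArg Complex.im h
  simp [pow_two] at hre him
  set α := c₁ ^ 2 / 4 - c₀ * c₂ with hα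
  set β := c₁ * c₂ * (2 * r₃ - r₁ - r₂) / 4 with hβ
  set γ := c₂ ^ 2 * (r₁ - r₂) ^ 2 / 4 with hγ
  -- Completing the square: L + iM = c₂z + c₁s/2 - c₂(r₁ + r₂)/2, and the equation reads (L + iM)² =
  -- αs² + 2βs + γ.
  set L := c₂ * a + c₁ / 2 * p - c₂ * (r₁ + r₂) / 2 with hL
  set M := c₂ * b + c₁ / 2 * q with hM
  have hMS : 0 < M ^ 2 - α * q ^ 2 := by
    have : M ^ 2 - α * q ^ 2 = c₂ * (c₂ * b ^ 2 + c₁ * b * q + c₀ * q ^ 2) := by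
      rw [hM, hα]; ring
    rw [this]; positivity
  have hLS : L ^ 2 - (α * p ^ 2 + 2 * β * p + γ) = M ^ 2 - α * q ^ 2 := by
    rw [hL, hM, hα, hβ, hγ]; linear_combination c₂ * hre
  have hB : L * M = α * p * q + β * q := by
    rw [hL, hM, hα, hβ]; linear_combination c₂ / 2 * him
  clear_value α β γ L M
  have hSq : 0 ≤ α * q ^ 2 := by simpa using hS q 0
  have hα0 : 0 ≤ α := nonneg_of_mul_nonneg_left hSq (by positivity)
  have hSp : 0 ≤ α * p ^ 2 + 2 * β * p + γ := by simpa using hS p 1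
  have hdet : β ^ 2 ≤ α * γ := by
    have h1 : discrim α (2 * β) γ ≤ 0 :=
      discrim_le_zero fun u => by have := hS u 1; linarith
    rw [discrim] at h1
    linarith
  have hCS : (α * p * q + β * q) ^ 2 ≤ (α * p ^ 2 + 2 * β * p + γ) * (α * q ^ 2) := by
    linarith [mul_nonneg (sub_nonneg.mpr hdet) (sq_nonneg q)]
  rw [← hB] at hCS
  have h3 : (α * p ^ 2 + 2 * β * p + γ) * (α * q ^ 2) < L ^ 2 * M ^ 2 := by
    obtain ⟨d, hd⟩ : ∃ d, d = M ^ 2 - α * q ^ 2 := ⟨_, rfl⟩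
    rw [← hd] at hMS hLS
    have hL2 : L ^ 2 = α * p ^ 2 + 2 * β * p + γ + d := by linarith
    have hM2 : M ^ 2 = α * q ^ 2 + d := by linarith
    rw [hL2, hM2]
    exact mul_lt_mul'' (by linarith) (by linarith) hSp hSq
  linarith

theorem im_nonneg_of_quadratic_eq_zero {c₀ c₁ c₂ r₁ r₂ r₃ : ℝ} (h₀ : 0 ≤ c₀) (h₁ : 0 ≤ c₁)
    (h₂ : 0 < c₂)
    (hS : ∀ u v : ℝ, 0 ≤ (c₁ ^ 2 / 4 - c₀ * c₂) * u ^ 2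
      + 2 * (c₁ * c₂ * (2 * r₃ - r₁ - r₂) / 4) * u * v + c₂ ^ 2 * (r₁ - r₂) ^ 2 / 4 * v ^ 2)
    {z w : ℂ} (hz : 0 < z.im)
    (hw : c₂ * (z - r₁) * (z - r₂) * w ^ 2 + c₁ * (z - r₃) * w + c₀ = 0) : 0 ≤ w.im := by
  by_contra! hneg
  have hw0 : w ≠ 0 := fun h => by simp [h] at hneg
  have hs : 0 < (w⁻¹).im := by
    rw [Complex.inv_im]
    exact div_pos (by linarith) (Complex.normSq_pos.mpr hw0)
  refine quadratic_ne_zero_of_im_pos h₀ h₁ h₂ hS hz hs ?_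
  field_simp
  linear_combination hw

theorem preservesHyperbolicity_quadraticDiffOp {c₀ c₁ c₂ r₁ r₂ r₃ : ℝ} (h₀ : 0 ≤ c₀)
    (h₁ : 0 ≤ c₁) (h₂ : 0 < c₂)
    (hS : ∀ u v : ℝ, 0 ≤ (c₁ ^ 2 / 4 - c₀ * c₂) * u ^ 2
      + 2 * (c₁ * c₂ * (2 * r₃ - r₁ - r₂) / 4) * u * v + c₂ ^ 2 * (r₁ - r₂) ^ 2 / 4 * v ^ 2) :
    PreservesHyperbolicity (quadraticDiffOp c₀ c₁ c₂ r₁ r₂ r₃) := by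
  intro f hf
  by_cases hdeg : f.natDegree ≤ 1
  · obtain ⟨a, b, rfl⟩ := exists_eq_X_add_C_of_natDegree_le_one hdeg
    apply isHyperbolic_of_natDegree_le_one
    rw [quadraticDiffOp_apply]
    simp only [derivative_add, derivative_mul, derivative_C, derivative_X, zero_mul, zero_add,
      mul_one, add_zero, mul_zero]
    compute_degree
  · have hf0 : f ≠ 0 := fun h => hdeg (by simp [h])
    have hroots := hf.resolve_left hf0
    apply isHyperbolic_of_forall_im_pos
    intro z hz h
    set F := f.map (algebraMap ℝ ℂ) with hF
    have hne : ∀ r : ℝ, z - r ≠ 0 := fun r h0 => by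
      have := congrArg Complex.im h0
      simp at this
      linarith
    have hQ : (c₂ : ℂ) * (z - r₁) * (z - r₂) ≠ 0 :=
      mul_ne_zero (mul_ne_zero (by exact_mod_cast h₂.ne') (hne r₁)) (hne r₂)
    -- Freeze the coefficients at z and factor the symbol of the operator over ℂ.
    obtain ⟨v, hv⟩ := exists_quadratic_eq_zero (b := (c₁ : ℂ) * (z - r₃)) (c := (c₀ : ℂ)) hQ
      (IsAlgClosed.exists_eq_mul_self _)
    obtain ⟨w, hw⟩ : ∃ w, w = -((c₁ : ℂ) * (z - r₃)) / (c₂ * (z - r₁) * (z - r₂)) - v := ⟨_, rfl⟩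
    have hsum : (c₂ : ℂ) * (z - r₁) * (z - r₂) * (v + w) = -(c₁ * (z - r₃)) := by
      rw [hw, add_sub_cancel, mul_div_cancel₀ _ hQ]
    have hprod : (c₂ : ℂ) * (z - r₁) * (z - r₂) * (v * w) = c₀ := by
      linear_combination v * hsum - hv
    have hv' : 0 ≤ v.im := im_nonneg_of_quadratic_eq_zero h₀ h₁ h₂ hS hz (w := v)
      (by linear_combination hv)
    have hw' : 0 ≤ w.im := im_nonneg_of_quadratic_eq_zero h₀ h₁ h₂ hS hz (w := w)
      (by linear_combination w * hsum - hprod)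
    refine eval_quadratic_derivative_ne_zero (f := F) ?_ ?_ hv' hw' hz ?_
    · rw [hF, natDegree_map]; omega
    · intro a ha
      rw [hF, eval_map_algebraMap] at ha
      exact (hroots a ha).le
    · rw [quadraticDiffOp_apply] at h
      simp only [map_add, map_mul, map_sub, aeval_C, aeval_X, Complex.coe_algebraMap] at h
      rw [hF, derivative_map, derivative_map, eval_map_algebraMap, eval_map_algebraMap,
        eval_map_algebraMap]
      apply (mul_right_injective₀ hQ)
      simp only [mul_zero]
      linear_combination h - aeval z (derivative f) * hsum + aeval z f * hprod

/-! ### Necessity of the discriminant condition -/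

/-- A quadratic factor of a nonzero hyperbolic polynomial has nonnegative discriminant. -/
theorem discrim_nonneg_of_isHyperbolic_mul {p : ℝ[X]} {a b c : ℝ} (hp : p ≠ 0) (ha : a ≠ 0)
    (h : IsHyperbolic (p * (C a * X ^ 2 + C b * X + C c))) : 0 ≤ b ^ 2 - 4 * a * c := by
  by_contra! hneg
  have hq : C a * X ^ 2 + C b * X + C c ≠ 0 := fun h0 => by
    have := natDegree_quadratic (b := b) (c := c) ha
    rw [h0] at this
    simp at this
  have hroots := h.resolve_left (mul_ne_zero hp hq)
  obtain ⟨s, hs⟩ : ∃ s, s = Real.sqrt (4 * a * c - b ^ 2) := ⟨_, rfl⟩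
  have hspos : 0 < s := hs ▸ Real.sqrt_pos.mpr (by linarith)
  have hsq : s ^ 2 = 4 * a * c - b ^ 2 := hs ▸ Real.sq_sqrt (by linarith)
  have haC : (a : ℂ) ≠ 0 := by exact_mod_cast ha
  have hsC : (s : ℂ) ^ 2 = 4 * a * c - b ^ 2 := by exact_mod_cast hsq
  have hz := hroots ((-b + s * Complex.I) / ((2 * a : ℝ) : ℂ)) (by
    simp only [map_mul, map_add, map_pow, aeval_C, aeval_X, Complex.coe_algebraMap]
    apply mul_eq_zero_of_right
    push_cast
    field_simp
    linear_combination (s : ℂ) ^ 2 * Complex.I_sq - hsC)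
  rw [Complex.div_ofReal_im] at hz
  simp [ha, hspos.ne'] at hz

theorem quadraticDiffOp_X_sub_C_pow (c₀ c₁ c₂ r₁ r₂ r₃ a : ℝ) (m : ℕ) :
    quadraticDiffOp c₀ c₁ c₂ r₁ r₂ r₃ ((X - C a) ^ (m + 2)) =
      (X - C a) ^ m * (C (c₂ * (m + 2) * (m + 1) + c₁ * (m + 2) + c₀) * X ^ 2
        + C (-(c₂ * (m + 2) * (m + 1) * (r₁ + r₂)) - c₁ * (m + 2) * (r₃ + a) - 2 * c₀ * a) * X
        + C (c₂ * (m + 2) * (m + 1) * (r₁ * r₂) + c₁ * (m + 2) * (r₃ * a) + c₀ * a ^ 2)) := by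
  rw [quadraticDiffOp_apply, derivative_X_sub_C_pow]
  simp only [Nat.add_succ_sub_one, derivative_mul, derivative_natCast, zero_mul, zero_add,
    derivative_X_sub_C_pow, map_add, map_mul, map_sub, map_neg, map_natCast, map_pow]
  push_cast
  simp only [map_ofNat, map_one]
  ring

open Filter Topology in
/-- Testing on high powers of `x - a` shows positivity of the discriminant form. -/
theorem discriminant_form_nonneg {c₀ c₁ c₂ r₁ r₂ r₃ : ℝ} (h₂ : 0 < c₂)
    (hT : PreservesHyperbolicity (quadraticDiffOp c₀ c₁ c₂ r₁ r₂ r₃)) (u : ℝ) :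
    0 ≤ (c₁ ^ 2 / 4 - c₀ * c₂) * u ^ 2
      + 2 * (c₁ * c₂ * (2 * r₃ - r₁ - r₂) / 4) * u + c₂ ^ 2 * (r₁ - r₂) ^ 2 / 4 := by
  -- Coefficients of the quadratic factor of T[(x - a)ᵐ⁺²] for a = -(m + 2)u, divided by (m + 2)²,
  -- with t = 1/(m + 2). At t = 0 the discriminant is four times the form.
  let α : ℝ → ℝ := fun t => c₂ * (1 - t) + c₁ * t + c₀ * t ^ 2
  let β : ℝ → ℝ := fun t =>
    -(c₂ * (1 - t) * (r₁ + r₂)) - c₁ * (r₃ * t - u) + 2 * c₀ * u * t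
  let γ : ℝ → ℝ := fun t => c₂ * (1 - t) * (r₁ * r₂) - c₁ * (r₃ * u) + c₀ * u ^ 2
  have hα : Continuous α := by fun_prop
  have hD : Continuous fun t => β t ^ 2 - 4 * α t * γ t := by fun_prop
  have ht : Tendsto (fun m : ℕ => 1 / ((m : ℝ) + 2)) atTop (𝓝 0) := by
    have := (tendsto_add_atTop_iff_nat 2).mpr (tendsto_one_div_atTop_nhds_zero_nat (𝕜 := ℝ))
    simpa using this
  have hev : ∀ᶠ m : ℕ in atTop, 0 ≤ β (1 / ((m : ℝ) + 2)) ^ 2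
      - 4 * α (1 / ((m : ℝ) + 2)) * γ (1 / ((m : ℝ) + 2)) := by
    have hα0 : 0 < α 0 := by simpa [α] using h₂
    filter_upwards [(hα.tendsto 0).comp ht |>.eventually (lt_mem_nhds hα0)] with m hm
    have hm' : 0 < α (1 / ((m : ℝ) + 2)) := hm
    have hn : (0 : ℝ) < m + 2 := by positivity
    have hX : IsHyperbolic ((X - C (-((m + 2) * u))) ^ (m + 2) : ℝ[X]) := by
      right
      intro z hz
      have : z - ((-((m + 2) * u) : ℝ) : ℂ) = 0 := by
        simpa only [map_pow, map_sub, aeval_X, aeval_C, Complex.coe_algebraMap] using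
          eq_zero_of_pow_eq_zero (n := m + 2) (by simpa using hz)
      rw [sub_eq_zero.mp this]
      exact Complex.ofReal_im _
    have h := hT _ hX
    rw [quadraticDiffOp_X_sub_C_pow] at h
    have e1 : c₂ * (m + 2) * (m + 1) + c₁ * (m + 2) + c₀
        = (m + 2) ^ 2 * α (1 / ((m : ℝ) + 2)) := by
      simp only [α]; field_simp; ring
    have e2 : -(c₂ * (m + 2) * (m + 1) * (r₁ + r₂)) - c₁ * (m + 2) * (r₃ + -((m + 2) * u))
        - 2 * c₀ * -((m + 2) * u) = (m + 2) ^ 2 * β (1 / ((m : ℝ) + 2)) := by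
      simp only [β]; field_simp; ring
    have e3 : c₂ * (m + 2) * (m + 1) * (r₁ * r₂) + c₁ * (m + 2) * (r₃ * -((m + 2) * u))
        + c₀ * (-((m + 2) * u)) ^ 2 = (m + 2) ^ 2 * γ (1 / ((m : ℝ) + 2)) := by
      simp only [γ]; field_simp; ring
    rw [e1, e2, e3] at h
    have h' := discrim_nonneg_of_isHyperbolic_mul (pow_ne_zero _ (X_sub_C_ne_zero _))
      (mul_pos (by positivity) hm').ne' h
    refine (mul_nonneg_iff_of_pos_left (c := ((m : ℝ) + 2) ^ 4) (by positivity)).mp ?_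
    linarith
  have hlim := ge_of_tendsto ((hD.tendsto 0).comp ht) hev
  simp only [α, β, γ] at hlim
  linarith

/-! ### Newton inequality and signs of the coefficients -/

/-- This is e₁² - 2e₂ = p₂; for real roots p₂ ≥ 0. -/
theorem sq_coeff_one_sub_coeff_two_prod (s : Multiset ℂ) :
    (s.map fun a => 1 - C a * X).prod.coeff 0 = 1 ∧
      (s.map fun a => 1 - C a * X).prod.coeff 1 ^ 2
        - 2 * (s.map fun a => 1 - C a * X).prod.coeff 2 = (s.map fun a => a ^ 2).sum := by
  induction s using Multiset.induction with
  | empty => simp [coeff_one]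
  | cons a s ih =>
    obtain ⟨h0, h1⟩ := ih
    rw [Multiset.map_cons, Multiset.prod_cons, Multiset.map_cons, Multiset.sum_cons]
    set q := (s.map fun a => 1 - C a * X).prod
    have e1 : ((1 - C a * X) * q).coeff 1 = q.coeff 1 - a * q.coeff 0 := by
      rw [sub_mul, one_mul, coeff_sub, mul_assoc, coeff_C_mul, coeff_X_mul]
    have e2 : ((1 - C a * X) * q).coeff 2 = q.coeff 2 - a * q.coeff 1 := by
      rw [sub_mul, one_mul, coeff_sub, mul_assoc, coeff_C_mul, coeff_X_mul]
    refine ⟨by simp [mul_coeff_zero, h0], ?_⟩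
    rw [e1, e2, h0, ← h1]
    ring

theorem reverse_prod_X_sub_C (s : Multiset ℂ) :
    (s.map fun a => X - C a).prod.reverse = (s.map fun a => 1 - C a * X).prod := by
  induction s using Multiset.induction with
  | empty => simpa using reverse_C (1 : ℂ)
  | cons a s ih =>
    rw [Multiset.map_cons, Multiset.prod_cons, reverse_mul_of_domain, ih, Multiset.map_cons,
      Multiset.prod_cons]
    congr 1
    rw [reverse, natDegree_X_sub_C, reflect_sub, reflect_C, pow_one]
    congr 1
    simp

/-- A weak Newton inequality for the three leading coefficients of a hyperbolic polynomial. -/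
theorem two_mul_coeff_mul_coeff_le {f : ℝ[X]} {n : ℕ} (hf : IsHyperbolic f)
    (hn : f.natDegree = n + 2) :
    2 * (f.coeff (n + 2) * f.coeff n) ≤ f.coeff (n + 1) ^ 2 := by
  have hf0 : f ≠ 0 := fun h => by simp [h] at hn
  have hroots := hf.resolve_left hf0
  set F := f.map (algebraMap ℝ ℂ) with hF
  have hF0 : F ≠ 0 := (Polynomial.map_ne_zero_iff (algebraMap ℝ ℂ).injective).mpr hf0
  have hFn : F.natDegree = n + 2 := by rw [hF, natDegree_map, hn]
  have hrev : F.reverse = C F.leadingCoeff * (F.roots.map fun a => 1 - C a * X).prod := by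
    conv_lhs => rw [(IsAlgClosed.splits F).eq_prod_roots]
    rw [reverse_mul_of_domain, reverse_C, reverse_prod_X_sub_C]
  have h1 := (sq_coeff_one_sub_coeff_two_prod F.roots).2
  have hc : ∀ k ≤ 2, F.reverse.coeff k = f.coeff (n + 2 - k) := by
    intro k hk
    rw [coeff_reverse, hFn, revAt_le (by omega), hF, coeff_map, Complex.coe_algebraMap]
  have hlc : F.leadingCoeff = f.coeff (n + 2) := by
    rw [leadingCoeff, hFn, hF, coeff_map, Complex.coe_algebraMap]
  have h2 := hc 1 (by omega)
  have h3 := hc 2 (by omega)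
  rw [hrev, coeff_C_mul, hlc] at h2 h3
  simp only [Nat.add_succ_sub_one, Nat.add_sub_cancel] at h2 h3
  obtain ⟨t, ht0, ht⟩ : ∃ t : ℝ, 0 ≤ t ∧ (F.roots.map fun a => a ^ 2).sum = (t : ℂ) := by
    have : ∀ a ∈ F.roots, a.im = 0 := fun a ha =>
      hroots a (by rw [← eval_map_algebraMap]; exact (mem_roots hF0).mp ha)
    generalize F.roots = s at this
    induction s using Multiset.induction with
    | empty => exact ⟨0, le_rfl, by simp⟩
    | cons a s ih =>
      obtain ⟨t, ht0, ht⟩ := ih fun b hb => this b (Multiset.mem_cons_of_mem hb)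
      have ha : a = (a.re : ℂ) :=
        Complex.ext rfl (by simpa using this a (Multiset.mem_cons_self a s))
      refine ⟨a.re ^ 2 + t, by positivity, ?_⟩
      rw [Multiset.map_cons, Multiset.sum_cons, ht, Complex.ofReal_add, Complex.ofReal_pow, ← ha]
  have key : f.coeff (n + 1) ^ 2 - 2 * (f.coeff (n + 2) * f.coeff n)
      = f.coeff (n + 2) ^ 2 * t := by
    have : ((f.coeff (n + 1) : ℝ) : ℂ) ^ 2 - 2 * ((f.coeff (n + 2) : ℝ) * (f.coeff n : ℝ))
        = (f.coeff (n + 2) : ℝ) ^ 2 * (t : ℂ) := by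
      rw [← h2, ← h3, ← ht, ← h1]
      ring
    exact_mod_cast this
  have : 0 ≤ f.coeff (n + 2) ^ 2 * t := by positivity
  linarith

/-- The leading coefficient by which `c₂ x² D² + c₁ x D + c₀` scales `x ^ k`. -/
def eulerSymbol (c₀ c₁ c₂ : ℝ) (k : ℕ) : ℝ := c₂ * (k * (k - 1)) + c₁ * k + c₀

theorem coeff_quadraticDiffOp (c₀ c₁ c₂ r₁ r₂ r₃ : ℝ) (f : ℝ[X]) (k : ℕ) :
    (quadraticDiffOp c₀ c₁ c₂ r₁ r₂ r₃ f).coeff k =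
      eulerSymbol c₀ c₁ c₂ k * f.coeff k
      + (-c₂ * (r₁ + r₂) * k - c₁ * r₃) * (k + 1) * f.coeff (k + 1)
      + c₂ * r₁ * r₂ * (k + 1) * (k + 2) * f.coeff (k + 2) := by
  have hexp : quadraticDiffOp c₀ c₁ c₂ r₁ r₂ r₃ f =
      C c₂ * (X * (X * derivative (derivative f)))
      - C (c₂ * (r₁ + r₂)) * (X * derivative (derivative f))
      + C (c₂ * r₁ * r₂) * derivative (derivative f)
      + C c₁ * (X * derivative f) - C (c₁ * r₃) * derivative f + C c₀ * f := by
    rw [quadraticDiffOp_apply]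
    simp only [map_add, map_mul]
    ring
  rw [hexp, eulerSymbol]
  simp only [coeff_add, coeff_sub, coeff_C_mul]
  rcases k with _ | _ | k
  · simp [coeff_derivative]
    ring
  · simp [coeff_derivative, coeff_X_mul]
    ring
  · simp only [coeff_X_mul, coeff_derivative]
    push_cast
    ring

theorem natDegree_quadraticDiffOp_le (c₀ c₁ c₂ r₁ r₂ r₃ : ℝ) (f : ℝ[X]) :
    (quadraticDiffOp c₀ c₁ c₂ r₁ r₂ r₃ f).natDegree ≤ f.natDegree := by
  rw [natDegree_le_iff_coeff_eq_zero]
  intro k hk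
  rw [coeff_quadraticDiffOp, coeff_eq_zero_of_natDegree_lt hk,
    coeff_eq_zero_of_natDegree_lt (hk.trans k.lt_succ_self),
    coeff_eq_zero_of_natDegree_lt (n := k + 2) (by omega)]
  ring

theorem isHyperbolic_X_pow_add_two_sub {M : ℝ} (hM : 0 ≤ M) (k : ℕ) :
    IsHyperbolic (X ^ (k + 2) - C M * X ^ k) := by
  right
  intro z hz
  have h : z ^ k * (z ^ 2 - M) = 0 := by
    simp only [map_sub, map_mul, map_pow, aeval_X, aeval_C, Complex.coe_algebraMap] at hz
    linear_combination hz
  rcases mul_eq_zero.mp h with h | h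
  · simp [eq_zero_of_pow_eq_zero h]
  · have hre := congrArg Complex.re h
    have him := congrArg Complex.im h
    simp [pow_two] at hre him
    by_contra hne
    have : z.re = 0 := by
      have : z.re * z.im = 0 := by linarith
      exact (mul_eq_zero.mp this).resolve_right hne
    rw [this] at hre
    have := mul_self_pos.mpr hne
    linarith

/-- If the symbol went from negative at k to positive at k + 2, the image of xᵏ(x² - M) would
violate the Newton inequality for large M. -/
theorem eulerSymbol_add_two_nonpos {c₀ c₁ c₂ r₁ r₂ r₃ : ℝ}
    (hT : PreservesHyperbolicity (quadraticDiffOp c₀ c₁ c₂ r₁ r₂ r₃)) {k : ℕ}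
    (hk : eulerSymbol c₀ c₁ c₂ k < 0) : eulerSymbol c₀ c₁ c₂ (k + 2) ≤ 0 := by
  by_contra! hk2
  set a := eulerSymbol c₀ c₁ c₂ k
  set b := eulerSymbol c₀ c₁ c₂ (k + 2)
  obtain ⟨B, hB⟩ : ∃ B, B = (-c₂ * (r₁ + r₂) * (k + 1) - c₁ * r₃) * (k + 2) := ⟨_, rfl⟩
  obtain ⟨E, hE⟩ : ∃ E, E = c₂ * r₁ * r₂ * (k + 1) * (k + 2) := ⟨_, rfl⟩
  have hab : 0 < -(2 * b * a) := by nlinarith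
  obtain ⟨M, hM⟩ : ∃ M, M = (B ^ 2 + |2 * b * E| + 1) / -(2 * b * a) := ⟨_, rfl⟩
  have hM0 : 0 ≤ M := by rw [hM]; positivity
  have hM' : M * -(2 * b * a) = B ^ 2 + |2 * b * E| + 1 := by
    rw [hM, div_mul_cancel₀ _ hab.ne']
  obtain ⟨f, hf⟩ : ∃ f : ℝ[X], f = X ^ (k + 2) - C M * X ^ k := ⟨_, rfl⟩
  have hdeg : f.natDegree ≤ k + 2 := by rw [hf]; compute_degree
  have f0 : f.coeff k = -M := by simp [hf, coeff_X_pow]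
  have f1 : f.coeff (k + 1) = 0 := by simp [hf, coeff_X_pow]
  have f2 : f.coeff (k + 2) = 1 := by simp [hf, coeff_X_pow]
  have f3 : f.coeff (k + 3) = 0 := coeff_eq_zero_of_natDegree_lt (by omega)
  have f4 : f.coeff (k + 4) = 0 := coeff_eq_zero_of_natDegree_lt (by omega)
  have g0 : (quadraticDiffOp c₀ c₁ c₂ r₁ r₂ r₃ f).coeff k = -(a * M) + E := by
    rw [coeff_quadraticDiffOp, f0, f1, f2, hE]; ring
  have g1 : (quadraticDiffOp c₀ c₁ c₂ r₁ r₂ r₃ f).coeff (k + 1) = B := by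
    rw [coeff_quadraticDiffOp, f1, f2, f3, hB]; push_cast; ring
  have g2 : (quadraticDiffOp c₀ c₁ c₂ r₁ r₂ r₃ f).coeff (k + 2) = b := by
    rw [coeff_quadraticDiffOp, f2, f3, f4]; ring
  have hg : (quadraticDiffOp c₀ c₁ c₂ r₁ r₂ r₃ f).natDegree = k + 2 :=
    le_antisymm ((natDegree_quadraticDiffOp_le _ _ _ _ _ _ f).trans hdeg)
      (le_natDegree_of_ne_zero (by rw [g2]; exact hk2.ne'))
  have := two_mul_coeff_mul_coeff_le
    (hT f (by rw [hf]; exact isHyperbolic_X_pow_add_two_sub hM0 k)) hg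
  rw [g0, g1, g2] at this
  linarith [neg_abs_le (2 * b * E)]

/-- By convexity in k a negative value would propagate to all later integers, yet the symbol tends
to +∞. -/
theorem eulerSymbol_nonneg {c₀ c₁ c₂ r₁ r₂ r₃ : ℝ} (h₂ : 0 < c₂)
    (hT : PreservesHyperbolicity (quadraticDiffOp c₀ c₁ c₂ r₁ r₂ r₃)) (k : ℕ) :
    0 ≤ eulerSymbol c₀ c₁ c₂ k := by
  by_contra! hk
  have hneg : ∀ j, k ≤ j → eulerSymbol c₀ c₁ c₂ j < 0 := by
    intro j hj
    induction j, hj using Nat.le_induction with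
    | base => exact hk
    | succ j _ ih =>
      have := eulerSymbol_add_two_nonpos hT ih
      simp only [eulerSymbol] at this ih ⊢
      push_cast at this ⊢
      linarith
  obtain ⟨N, hN⟩ := exists_nat_ge ((|c₁| + |c₀|) / c₂)
  have hN' := (div_le_iff₀ h₂).mp hN
  have h := hneg (k + N + 1) (by omega)
  simp only [eulerSymbol] at h
  push_cast at h
  have hk0 : (0 : ℝ) ≤ k := k.cast_nonneg
  have hN0 : (0 : ℝ) ≤ N := N.cast_nonneg
  have h1 : 0 ≤ (c₂ * (k + N) - (|c₁| + |c₀|)) * ((k : ℝ) + N + 1) :=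
    mul_nonneg (by nlinarith) (by positivity)
  have h2 : 0 ≤ (|c₁| + c₁) * ((k : ℝ) + N + 1) :=
    mul_nonneg (by linarith [neg_abs_le c₁]) (by positivity)
  have h3 : 0 ≤ |c₀| * ((k : ℝ) + N) := by positivity
  linarith [neg_abs_le c₀]

theorem coeffs_nonneg_of_eulerSymbol_nonneg {c₀ c₁ c₂ : ℝ} (h₂ : 0 < c₂)
    (hdisc : 0 ≤ c₁ ^ 2 / 4 - c₀ * c₂) (h : ∀ k, 0 ≤ eulerSymbol c₀ c₁ c₂ k) :
    0 ≤ c₀ ∧ 0 ≤ c₁ := by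
  refine ⟨by simpa [eulerSymbol] using h 0, ?_⟩
  by_contra! hc
  -- The vertex of the symbol. An integer within 1/2 of it gives 4c₂ times the symbol at most c₂² -
  -- (c₂ - c₁)² + c₁² = 2c₁c₂ < 0.
  obtain ⟨v, hv⟩ : ∃ v, v = (c₂ - c₁) / (2 * c₂) := ⟨_, rfl⟩
  have hv0 : 0 < v := by rw [hv]; exact div_pos (by linarith) (by linarith)
  have hv' : 2 * c₂ * v = c₂ - c₁ := by rw [hv]; field_simp
  have h1 := Nat.floor_le (a := v + 1 / 2) (by linarith)
  have h2 := Nat.lt_floor_add_one (v + 1 / 2)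
  have hk := h ⌊v + 1 / 2⌋₊
  generalize (⌊v + 1 / 2⌋₊ : ℕ) = k at h1 h2 hk
  rw [eulerSymbol] at hk
  have hsq : ((k : ℝ) - v) ^ 2 ≤ 1 / 4 := by nlinarith
  have hid : 4 * c₂ * (c₂ * (k * (k - 1)) + c₁ * k + c₀)
      = 4 * c₂ ^ 2 * ((k : ℝ) - v) ^ 2 - (c₂ - c₁) ^ 2 + 4 * c₂ * c₀ := by
    rw [← hv']
    linear_combination (4 * c₂ * k) * hv'
  have h3 := mul_le_mul_of_nonneg_left hsq (show 0 ≤ 4 * c₂ ^ 2 by positivity)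
  have h4 : 0 ≤ 4 * c₂ * (c₂ * (k * (k - 1)) + c₁ * k + c₀) := by positivity
  nlinarith

/-! ### From the form to the stated criterion -/

theorem discriminant_form_nonneg_iff {c₀ c₁ c₂ r₁ r₂ r₃ : ℝ} (h₂ : 0 < c₂)
    (hr : r₁ = r₂ → c₁ = 0 ∨ r₃ = r₁) :
    (∀ u v : ℝ, 0 ≤ (c₁ ^ 2 / 4 - c₀ * c₂) * u ^ 2
      + 2 * (c₁ * c₂ * (2 * r₃ - r₁ - r₂) / 4) * u * v + c₂ ^ 2 * (r₁ - r₂) ^ 2 / 4 * v ^ 2) ↔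
      0 ≤ c₁ ^ 2 * rootRatio r₁ r₂ r₃ - c₂ * c₀ := by
  by_cases h : r₁ = r₂
  · have hβ : c₁ * c₂ * (2 * r₃ - r₁ - r₂) / 4 = 0 := by
      rcases hr h with h0 | h0
      · simp [h0]
      · rw [h0, ← h]; ring
    rw [hβ, rootRatio, if_pos h]
    constructor
    · intro hS
      have := hS 1 0
      linarith
    · intro hD u v
      have := mul_nonneg hD (sq_nonneg u)
      rw [h]
      linarith
  · have hd : 0 < (r₂ - r₁) ^ 2 := by
      have : r₂ - r₁ ≠ 0 := sub_ne_zero.mpr (Ne.symm h)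
      positivity
    obtain ⟨D, hD⟩ : ∃ D, D = c₁ ^ 2 * rootRatio r₁ r₂ r₃ - c₂ * c₀ := ⟨_, rfl⟩
    have hD' : (r₂ - r₁) ^ 2 * D
        = c₁ ^ 2 * ((r₁ - r₃) * (r₃ - r₂)) - (r₂ - r₁) ^ 2 * (c₂ * c₀) := by
      rw [hD, rootRatio, if_neg h]
      field_simp
    have hid : ∀ u v : ℝ, (r₂ - r₁) ^ 2 * ((c₁ ^ 2 / 4 - c₀ * c₂) * u ^ 2
        + 2 * (c₁ * c₂ * (2 * r₃ - r₁ - r₂) / 4) * u * v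
        + c₂ ^ 2 * (r₁ - r₂) ^ 2 / 4 * v ^ 2)
        = (c₁ * (2 * r₃ - r₁ - r₂) * u + c₂ * (r₂ - r₁) ^ 2 * v) ^ 2 / 4
          + (r₂ - r₁) ^ 2 * D * u ^ 2 := by
      intro u v
      rw [hD']
      ring
    rw [← hD]
    constructor
    · intro hS
      -- This vector annihilates the square in `hid`.
      have h1 := mul_nonneg hd.le (hS (c₂ * (r₂ - r₁) ^ 2) (-(c₁ * (2 * r₃ - r₁ - r₂))))
      rw [hid] at h1
      have h3 : 0 < (r₂ - r₁) ^ 2 * (c₂ * (r₂ - r₁) ^ 2) ^ 2 := by positivity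
      refine (mul_nonneg_iff_of_pos_left h3).mp ?_
      linarith
    · intro hD0 u v
      refine (mul_nonneg_iff_of_pos_left hd).mp ?_
      rw [hid]
      positivity

theorem preservesHyperbolicity_quadraticDiffOp_iff_of_pos {c₀ c₁ c₂ r₁ r₂ r₃ : ℝ} (h₂ : 0 < c₂)
    (hr : r₁ = r₂ → c₁ = 0 ∨ r₃ = r₁) :
    PreservesHyperbolicity (quadraticDiffOp c₀ c₁ c₂ r₁ r₂ r₃) ↔
      SameSign c₀ c₁ c₂ ∧ 0 ≤ c₁ ^ 2 * rootRatio r₁ r₂ r₃ - c₂ * c₀ := by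
  rw [← discriminant_form_nonneg_iff h₂ hr]
  constructor
  · intro hT
    have hS := discriminant_form_nonneg h₂ hT
    have hα : 0 ≤ c₁ ^ 2 / 4 - c₀ * c₂ := by
      by_contra! hneg
      obtain ⟨α, hα⟩ : ∃ α, α = c₁ ^ 2 / 4 - c₀ * c₂ := ⟨_, rfl⟩
      obtain ⟨γ, hγ⟩ : ∃ γ, γ = c₂ ^ 2 * (r₁ - r₂) ^ 2 / 4 := ⟨_, rfl⟩
      simp only [← hα, ← hγ] at hneg hS
      -- Adding the values at ±u cancels the cross term, and u is large enough that αu² + γ < 0.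
      have h1 := hS ((γ + 1) / -α + 1)
      have h2 := hS (-((γ + 1) / -α + 1))
      have hγ0 : 0 ≤ γ := by rw [hγ]; positivity
      have h3 : (γ + 1) / -α * α = -(γ + 1) := by field_simp [hneg.ne]
      have h4 : 0 ≤ (γ + 1) / -α := div_nonneg (by linarith) (by linarith)
      nlinarith [mul_nonneg h4 (show 0 ≤ γ + 1 by linarith)]
    obtain ⟨h₀, h₁⟩ := coeffs_nonneg_of_eulerSymbol_nonneg h₂ hα (eulerSymbol_nonneg h₂ hT)
    refine ⟨Or.inl ⟨h₀, h₁, h₂.le⟩, fun u v => ?_⟩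
    by_cases hv : v = 0
    · rw [hv]
      simpa using mul_nonneg hα (sq_nonneg u)
    · have := mul_nonneg (hS (u / v)) (sq_nonneg v)
      field_simp at this
      linarith
  · rintro ⟨hs, hS⟩
    rcases hs with ⟨h₀, h₁, -⟩ | ⟨-, -, h⟩
    · exact preservesHyperbolicity_quadraticDiffOp h₀ h₁ h₂ hS
    · exact absurd h₂ h.not_gt

theorem preservesHyperbolicity_quadraticDiffOp_iff {c₀ c₁ c₂ r₁ r₂ r₃ : ℝ} (h₂ : c₂ ≠ 0)
    (hr : r₁ = r₂ → c₁ = 0 ∨ r₃ = r₁) :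
    PreservesHyperbolicity (quadraticDiffOp c₀ c₁ c₂ r₁ r₂ r₃) ↔
      SameSign c₀ c₁ c₂ ∧ 0 ≤ c₁ ^ 2 * rootRatio r₁ r₂ r₃ - c₂ * c₀ := by
  rcases h₂.lt_or_gt with hneg | hpos
  · have h := preservesHyperbolicity_quadraticDiffOp_iff_of_pos (c₀ := -c₀) (c₁ := -c₁)
      (neg_pos.mpr hneg) (r₁ := r₁) (r₂ := r₂) (r₃ := r₃) (by simpa using hr)
    rw [quadraticDiffOp_neg, neg_sq, neg_mul_neg] at h
    have hs : SameSign (-c₀) (-c₁) (-c₂) ↔ SameSign c₀ c₁ c₂ := by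
      simp only [SameSign, neg_nonneg, neg_nonpos]
      exact or_comm
    rw [hs] at h
    rw [← h]
    exact ⟨preservesHyperbolicity_neg, fun hT => by simpa using preservesHyperbolicity_neg hT⟩
  · exact preservesHyperbolicity_quadraticDiffOp_iff_of_pos hpos hr

theorem mainTheorem7 (P : Polynomial.Sequence ℝ) (A : ℕ → ℝ)
    (c₀ c₁ c₂ r₁ r₂ r₃ : ℝ) (hc₂ : c₂ ≠ 0)
    (hr : r₁ = r₂ → c₁ = 0 ∨ r₃ = r₁)
    (hP : ∀ n : ℕ,
      C c₂ * (X - C r₁) * (X - C r₂) * derivative (derivative (P n))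
        + C c₁ * (X - C r₃) * derivative (P n) + C c₀ * P n = C (A n) * P n) :
    IsMultiplierSequence (simpleSetBasis P) A ↔
      SameSign c₀ c₁ c₂ ∧ 0 ≤ c₁ ^ 2 * rootRatio r₁ r₂ r₃ - c₂ * c₀ := by
  rw [← preservesHyperbolicity_quadraticDiffOp_iff hc₂ hr]
  have hop : ∀ n, quadraticDiffOp c₀ c₁ c₂ r₁ r₂ r₃ (simpleSetBasis P n)
      = A n • simpleSetBasis P n := fun n => by
    rw [simpleSetBasis_apply, quadraticDiffOp_apply, hP, smul_eq_C_mul]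
  constructor
  · rintro ⟨T, hT, hTP⟩
    rwa [← (simpleSetBasis P).ext fun n => (hTP n).trans (hop n).symm]
  · exact fun hT => ⟨_, hT, hop⟩
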